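/- Let $P$ be a finite graded poset of rank $n$ (every maximal chain has $n+1$ elements) with a least element $\hat 0$ and a greatest element $\hat 1$, and let $\rho$ be its rank function. For $S\subseteq[n-1]=\{1,\dots,n-1\}$ let $\alpha_P(S)$ be the number of chains $C$ of $P$ with $\{\rho(t):t\in C\}=S$, and let $\beta_P(S)=\sum_{T\subseteq S}(-1)^{\#(S-T)}\alpha_P(T)$ (the flag $h$-vector of $P$). Call $\beta_P$ multiplicity-free if $\beta_P(S)\in\{0,1,-1\}$ for all $S\subseteq[n-1]$. Let $h(n,k)$ be the number of isomorphism classes of $k$-element graded posets $P$ of rank $n$ with $\hat 0$ and $\hat 1$ for which $\beta_P$ is multiplicity-free. Then, as formal power series, $$U(x,y):=\sum_{n\ge 1}\sum_{k\ge 2}h(n,k)\,x^n y^k=\frac{xy^2(1-xy^2)(1-3xy^2)}{1-xy-5xy^2+4x^2y^3+5x^2y^4-3x^3y^5}.$$ -/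

import Mathlib

/-- Every maximal chain of the poset has length `n`, that is, `n + 1` elements. -/
def IsGradedOfRank (P : Type*) [PartialOrder P] (n : ℕ) : Prop :=
  ∀ C : Set P, IsMaxChain (· ≤ ·) C → C.ncard = n + 1

/-- The poset has a least element `0̂` and a greatest element `1̂`. -/
def HasZeroOne (P : Type*) [PartialOrder P] : Prop :=
  (∃ b : P, IsBot b) ∧ (∃ t : P, IsTop t)

/-- The rank of `t`: the length of a longest chain with top element `t`. On a finite graded
poset this is the rank function. -/
noncomputable def posetRank {P : Type*} [PartialOrder P] (t : P) : ℕ :=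
  (Order.height t).toNat

/-- The flag `f`-vector: the number of chains whose set of ranks is `S`. -/
noncomputable def flagF (P : Type*) [PartialOrder P] (S : Finset ℕ) : ℕ :=
  Set.ncard {C : Finset P | IsChain (· ≤ ·) (C : Set P) ∧ C.image posetRank = S}

/-- The flag `h`-vector. -/
noncomputable def flagH (P : Type*) [PartialOrder P] (S : Finset ℕ) : ℤ :=
  ∑ T ∈ S.powerset, (-1) ^ (S \ T).card * (flagF P T : ℤ)

/-- The flag `h`-vector of a poset of rank `n` takes only the values `0`, `1`, `-1` on the
subsets of `{1, …, n - 1}`. -/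
def FlagHMultiplicityFree (P : Type*) [PartialOrder P] (n : ℕ) : Prop :=
  ∀ S : Finset ℕ, S ⊆ Finset.Ico 1 n → flagH P S = 0 ∨ flagH P S = 1 ∨ flagH P S = -1

/-- The partial orders on `Fin k` that are graded of rank `n`, have `0̂` and `1̂`, and have a
multiplicity-free flag `h`-vector. -/
def MFPoset (n k : ℕ) : Type :=
  {p : PartialOrder (Fin k) //
    @IsGradedOfRank (Fin k) p n ∧ @HasZeroOne (Fin k) p ∧ @FlagHMultiplicityFree (Fin k) p n}

/-- Isomorphism of posets on `Fin k`. -/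
def MFPoset.isoSetoid (n k : ℕ) : Setoid (MFPoset n k) where
  r p q := Nonempty (@OrderIso (Fin k) (Fin k) p.1.toLE q.1.toLE)
  iseqv :=
    { refl := fun p => ⟨@OrderIso.refl (Fin k) p.1.toLE⟩
      symm := fun {p q} ⟨e⟩ => ⟨@OrderIso.symm (Fin k) (Fin k) p.1.toLE q.1.toLE e⟩
      trans := fun {p q r} ⟨e⟩ ⟨f⟩ =>
        ⟨@OrderIso.trans (Fin k) (Fin k) (Fin k) p.1.toLE q.1.toLE r.1.toLE e f⟩ }

/-- The number of isomorphism classes of graded `k`-element posets of rank `n` with `0̂` and `1̂`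
and with a multiplicity-free flag `h`-vector. -/
noncomputable def mfCount (n k : ℕ) : ℕ :=
  Nat.card (Quotient (MFPoset.isoSetoid n k))

/-- The formal power series `∑_{n ≥ 1} ∑_{k ≥ 2} h(n,k) x ^ n y ^ k`; the variable `x` has
index `0` and the variable `y` has index `1`. -/
noncomputable def mfGenFun : MvPowerSeries (Fin 2) ℚ :=
  fun m => if 1 ≤ m 0 ∧ 2 ≤ m 1 then (mfCount (m 0) (m 1) : ℚ) else 0

/-! Up to sign, `flagH P S` is the alternating chain count χ (`chainEuler`) of the subposet of
elements with rank in `S`. For `S = {i}` it is the size of level `i` minus one, so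
multiplicity-freeness forces levels of size at most two. Conversely, remove the top rank `j` of `S`,
leaving `A`. Adding an element `s` of rank `j` subtracts χ of the part of `A` below `s`, which is
either a cone (χ = 0) or has the same χ as `A`. With at most two such `s`, χ is multiplied by 1, 0
or -1. This is `IsRankFn.flagHMultiplicityFree_iff`.

It remains to count bounded graded posets with levels of size at most two. Such a poset grows level
by level. Above a pair there can be one point, or a second pair joined completely, by a matching, or
by all relations but one. The last choice can be made in one or two inequivalent ways, according to
whether the lower pair is exchanged by an automorphism of the part below. The three states of
`LevelKind` record this, so isomorphism classes correspond to words accepted by a finite automaton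
(`IsRankFn.exists_isLabelling`, `IsLabelling.eq_of_isNormalForm`, `mfCount_eq_card_isCode`). Its
transfer matrix gives three linear equations for the generating functions, and elimination gives the
formula. -/

/-! ### Rank functions and graded posets -/

/-- A function `r` that increases by one along covers, is `0` at a least element and `n` at a
greatest element. -/
structure IsRankFn {P : Type*} [PartialOrder P] (r : P → ℕ) (n : ℕ) : Prop where
  covBy : ∀ ⦃a b : P⦄, a ⋖ b → r b = r a + 1
  bot : ∃ b : P, IsBot b ∧ r b = 0
  top : ∃ t : P, IsTop t ∧ r t = n

theorem IsRankFn.hasZeroOne {P : Type*} [PartialOrder P] {r : P → ℕ} {n : ℕ}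
    (h : IsRankFn r n) : HasZeroOne P := by
  obtain ⟨b, hb, -⟩ := h.bot
  obtain ⟨t, ht, -⟩ := h.top
  exact ⟨⟨b, hb⟩, ⟨t, ht⟩⟩

theorem IsMaxChain.mem_of_forall_le_or_le {P : Type*} [PartialOrder P] {C : Set P} (hC : IsMaxChain (· ≤ ·) C) {x : P}
    (hx : ∀ y ∈ C, x ≤ y ∨ y ≤ x) : x ∈ C := by
  have := hC.2 (hC.1.insert fun b hb _ => hx b hb) (Set.subset_insert x C)
  rw [this]
  exact Set.mem_insert x C

/-- The part below `a` of one maximal chain through `a` can be combined with the part above `a`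
of another. -/
theorem IsMaxChain.inter_Iic_union_inter_Ici {P : Type*} [PartialOrder P] {C D : Set P} (hC : IsMaxChain (· ≤ ·) C)
    (hD : IsMaxChain (· ≤ ·) D) {a : P} (haC : a ∈ C) (haD : a ∈ D) :
    IsMaxChain (· ≤ ·) (C ∩ Set.Iic a ∪ D ∩ Set.Ici a) := by
  refine ⟨?_, fun E hE hsub => Set.Subset.antisymm hsub fun x hx => ?_⟩
  · rintro x (⟨hx, hxa⟩ | ⟨hx, hxa⟩) y (⟨hy, hya⟩ | ⟨hy, hya⟩) hne
    · exact hC.1 hx hy hne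
    · exact Or.inl (le_trans hxa hya)
    · exact Or.inr (le_trans hya hxa)
    · exact hD.1 hx hy hne
  · have hcomp : ∀ y ∈ C ∩ Set.Iic a ∪ D ∩ Set.Ici a, x ≤ y ∨ y ≤ x := fun y hy =>
      hE.total hx (hsub hy)
    rcases hcomp a (Or.inl ⟨haC, le_rfl⟩) with hxa | hax
    · refine Or.inl ⟨hC.mem_of_forall_le_or_le fun y hy => ?_, hxa⟩
      rcases hC.1.total hy haC with h1 | h1
      · exact hcomp y (Or.inl ⟨hy, h1⟩)
      · exact Or.inl (hxa.trans h1)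
    · refine Or.inr ⟨hD.mem_of_forall_le_or_le fun y hy => ?_, hax⟩
      rcases hD.1.total hy haD with h1 | h1
      · exact Or.inr (h1.trans hax)
      · exact hcomp y (Or.inr ⟨hy, h1⟩)

section Rank

variable {P : Type*} [PartialOrder P] [Finite P]

theorem le_iff_reflTransGen_covBy_of_finite {a b : P} :
    a ≤ b ↔ Relation.ReflTransGen (· ⋖ ·) a b := by
  classical
  cases nonempty_fintype P
  let _ : LocallyFiniteOrder P := Fintype.toLocallyFiniteOrder
  exact le_iff_reflTransGen_covBy

namespace IsRankFn

variable {r : P → ℕ} {n : ℕ}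

theorem monotone (h : IsRankFn r n) : Monotone r := by
  intro a b hab
  rw [le_iff_reflTransGen_covBy_of_finite] at hab
  induction hab with
  | refl => exact le_rfl
  | tail _ hbc ih => have := h.covBy hbc; omega

theorem strictMono (h : IsRankFn r n) : StrictMono r := by
  intro a b hab
  obtain ⟨c, hac, hcb⟩ := exists_covBy_le_of_lt hab
  have h1 := h.covBy hac
  have h2 := h.monotone hcb
  omega

theorem le (h : IsRankFn r n) (a : P) : r a ≤ n := by
  obtain ⟨t, ht, rfl⟩ := h.top
  exact h.monotone (ht a)

theorem eq_of_rank_eq_zero (h : IsRankFn r n) {a b : P} (ha : r a = 0) (hb : r b = 0) :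
    a = b := by
  obtain ⟨t, ht, h0⟩ := h.bot
  have key : ∀ c, r c = 0 → t = c := fun c hc => by
    by_contra hne
    have := h.strictMono (lt_of_le_of_ne (ht c) hne)
    omega
  rw [← key a ha, ← key b hb]

theorem eq_of_rank_eq_top (h : IsRankFn r n) {a b : P} (ha : r a = n) (hb : r b = n) :
    a = b := by
  obtain ⟨t, ht, h0⟩ := h.top
  have key : ∀ c, r c = n → c = t := fun c hc => by
    by_contra hne
    have := h.strictMono (lt_of_le_of_ne (ht c) hne)
    omega
  rw [key a ha, key b hb]

theorem eq_of_le (h : IsRankFn r n) {a b : P} (hab : a ≤ b) (hr : r a = r b) : a = b := by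
  by_contra hne
  have := h.strictMono (lt_of_le_of_ne hab hne)
  omega

theorem covBy_of_le (h : IsRankFn r n) {a b : P} (hab : a ≤ b) (hr : r b = r a + 1) : a ⋖ b := by
  refine ⟨lt_of_le_of_ne hab (by rintro rfl; omega), fun c hac hcb => ?_⟩
  have h1 := h.strictMono hac
  have h2 := h.strictMono hcb
  omega

/-- Between two comparable elements there are elements of all intermediate ranks. -/
theorem exists_between (h : IsRankFn r n) {a b : P} (hab : a ≤ b) {i : ℕ} (hi : r a ≤ i)
    (hi' : i ≤ r b) : ∃ c, a ≤ c ∧ c ≤ b ∧ r c = i := by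
  have hab' := le_iff_reflTransGen_covBy_of_finite.1 hab
  induction hab' with
  | refl => exact ⟨a, le_rfl, le_rfl, le_antisymm hi hi'⟩
  | @tail c d hac hcd ih =>
    rcases Nat.lt_or_ge (r c) i with hlt | hge
    · have := h.covBy hcd
      exact ⟨d, hab, le_rfl, by omega⟩
    · obtain ⟨e, h1, h2, h3⟩ := ih (le_iff_reflTransGen_covBy_of_finite.2 hac) hge
      exact ⟨e, h1, h2.trans hcd.le, h3⟩

theorem exists_covBy_below (h : IsRankFn r n) {b : P} {i : ℕ} (hb : r b = i + 1) :
    ∃ a, a ⋖ b ∧ r a = i := by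
  obtain ⟨t, ht, h0⟩ := h.bot
  obtain ⟨c, -, hcb, hc⟩ := h.exists_between (ht b) (i := i) (by omega) (by omega)
  exact ⟨c, h.covBy_of_le hcb (by omega), hc⟩

theorem exists_covBy_above (h : IsRankFn r n) {a : P} (ha : r a < n) :
    ∃ b, a ⋖ b ∧ r b = r a + 1 := by
  obtain ⟨t, ht, rfl⟩ := h.top
  obtain ⟨c, hac, -, hc⟩ := h.exists_between (ht a) (i := r a + 1) (by omega) (by omega)
  exact ⟨c, h.covBy_of_le hac hc, hc⟩

theorem exists_rank_eq (h : IsRankFn r n) {i : ℕ} (hi : i ≤ n) : ∃ a, r a = i := by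
  obtain ⟨t, ht, rfl⟩ := h.top
  obtain ⟨b, hb, h0⟩ := h.bot
  obtain ⟨c, -, -, hc⟩ := h.exists_between (hb t) (i := i) (by omega) (by omega)
  exact ⟨c, hc⟩

theorem height_eq (h : IsRankFn r n) (a : P) : Order.height a = r a := by
  induction a using (wellFounded_lt (α := P)).induction with
  | _ a ih =>
  refine le_antisymm ?_ ?_
  · rw [Order.height_le_coe_iff]
    intro y hy
    rw [ih y hy]
    exact_mod_cast h.strictMono hy
  · rcases hr : r a with _ | i
    · simp
    · obtain ⟨b, hb, rfl⟩ := h.exists_covBy_below hr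
      have := Order.height_add_one_le hb.lt
      rw [ih b hb.lt] at this
      exact_mod_cast this

/-- Rank functions are unique, so any convenient `r` may stand for `posetRank`, and isomorphisms
preserve rank. -/
theorem posetRank_eq (h : IsRankFn r n) : (posetRank : P → ℕ) = r := by
  funext a
  simp [posetRank, h.height_eq]

end IsRankFn

theorem IsRankFn.isGradedOfRank {r : P → ℕ} {n : ℕ} (h : IsRankFn r n) : IsGradedOfRank P n := by
  intro C hC
  have hinj : Set.InjOn r C := by
    intro a ha b hb hab
    rcases hC.1.total ha hb with h1 | h1
    · exact h.eq_of_le h1 hab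
    · exact (h.eq_of_le h1 hab.symm).symm
  have himg : r '' C = Set.Iic n := by
    apply Set.Subset.antisymm
    · rintro _ ⟨a, -, rfl⟩
      exact h.le a
    · intro j hj
      by_contra hno
      have hne : ∀ c ∈ C, r c ≠ j := fun c hc hcj => hno ⟨c, hc, hcj⟩
      obtain ⟨b, hb, hb0⟩ := h.bot
      obtain ⟨t, ht, htn⟩ := h.top
      have hbC : b ∈ C := hC.mem_of_forall_le_or_le fun y _ => Or.inl (hb y)
      have htC : t ∈ C := hC.mem_of_forall_le_or_le fun y _ => Or.inr (ht y)
      -- If the chain skips rank `j`, an element of rank `j` between its neighbours `a` and `d` is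
      -- comparable to the whole chain, contradicting maximality.
      obtain ⟨a, ⟨haC, haj⟩, hamax⟩ := Set.exists_max_image {c | c ∈ C ∧ r c < j} r
        (Set.toFinite _) ⟨b, hbC, lt_of_le_of_ne (by omega) (hne b hbC)⟩
      obtain ⟨d, ⟨hdC, hdj⟩, hdmin⟩ := Set.exists_min_image {c | c ∈ C ∧ j < r c} r
        (Set.toFinite _) ⟨t, htC, lt_of_le_of_ne (by simp at hj; omega) (hne t htC).symm⟩
      have had : a ≤ d := by
        rcases hC.1.total haC hdC with h1 | h1
        · exact h1
        · have := h.monotone h1; omega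
      obtain ⟨c, hac, hcd, hc⟩ := h.exists_between had (i := j) (by omega) (by omega)
      refine hne c (hC.mem_of_forall_le_or_le fun y hy => ?_) hc
      rcases lt_or_gt_of_ne (hne y hy) with h1 | h1
      · right
        refine le_trans ?_ hac
        rcases hC.1.total hy haC with h2 | h2
        · exact h2
        · have h3 := hamax y ⟨hy, h1⟩
          exact (h.eq_of_le h2 (le_antisymm (h.monotone h2) h3)).ge
      · left
        refine le_trans hcd ?_
        rcases hC.1.total hdC hy with h2 | h2
        · exact h2
        · have h3 := hdmin y ⟨hy, h1⟩
          exact (h.eq_of_le h2 (le_antisymm (h.monotone h2) h3)).ge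
  rw [← hinj.ncard_image, himg, ← Finset.coe_Iic, Set.ncard_coe_finset]
  simp

/-- The spliced chain is maximal, so it has `n + 1` elements, and `a` is counted twice. Hence the
number of elements below `a` does not depend on the maximal chain through `a`, which makes the rank
well defined. -/
theorem ncard_inter_Iic_add_ncard_inter_Ici {n : ℕ} (hP : IsGradedOfRank P n) {C D : Set P}
    (hC : IsMaxChain (· ≤ ·) C) (hD : IsMaxChain (· ≤ ·) D) {a : P} (haC : a ∈ C) (haD : a ∈ D) :
    (C ∩ Set.Iic a).ncard + (D ∩ Set.Ici a).ncard = n + 2 := by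
  have h1 := hP _ (hC.inter_Iic_union_inter_Ici hD haC haD)
  have h2 := Set.ncard_union_add_ncard_inter (C ∩ Set.Iic a) (D ∩ Set.Ici a)
  have h3 : C ∩ Set.Iic a ∩ (D ∩ Set.Ici a) = {a} := by
    ext x
    constructor
    · rintro ⟨⟨-, h1⟩, ⟨-, h2⟩⟩
      exact le_antisymm h1 h2
    · rintro rfl
      exact ⟨⟨haC, le_rfl⟩, ⟨haD, le_rfl⟩⟩
  rw [h3, Set.ncard_singleton] at h2
  omega

theorem IsGradedOfRank.exists_isRankFn {n : ℕ} (hP : IsGradedOfRank P n) (h01 : HasZeroOne P) :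
    ∃ r : P → ℕ, IsRankFn r n := by
  have hex : ∀ a : P, ∃ C : Set P, IsMaxChain (· ≤ ·) C ∧ a ∈ C := fun a => by
    obtain ⟨M, hM, hsub⟩ := (IsChain.singleton (r := (· ≤ ·)) (a := a)).exists_maxChain
    exact ⟨M, hM, hsub rfl⟩
  choose C hC haC using hex
  have hconst : ∀ a D, IsMaxChain (· ≤ ·) D → a ∈ D →
      (D ∩ Set.Iic a).ncard = (C a ∩ Set.Iic a).ncard := fun a D hD ha => by
    have h1 := ncard_inter_Iic_add_ncard_inter_Ici hP hD (hC a) ha (haC a)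
    have h2 := ncard_inter_Iic_add_ncard_inter_Ici hP (hC a) (hC a) (haC a) (haC a)
    omega
  obtain ⟨⟨b, hb⟩, ⟨t, ht⟩⟩ := h01
  refine ⟨fun a => (C a ∩ Set.Iic a).ncard - 1, ?_, ⟨b, hb, ?_⟩, ⟨t, ht, ?_⟩⟩
  · intro a d had
    obtain ⟨M, hM, hsub⟩ := (IsChain.pair (r := (· ≤ ·)) had.le).exists_maxChain
    have haM : a ∈ M := hsub (by simp)
    have hdM : d ∈ M := hsub (by simp)
    have hins : M ∩ Set.Iic d = insert d (M ∩ Set.Iic a) := by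
      ext x
      constructor
      · rintro ⟨hx, hxd⟩
        rcases hM.1.total hx haM with h1 | h1
        · exact Or.inr ⟨hx, h1⟩
        · rcases had.eq_or_eq h1 hxd with rfl | rfl
          · exact Or.inr ⟨hx, h1⟩
          · exact Or.inl rfl
      · rintro (rfl | ⟨hx, hxa⟩)
        · exact ⟨hdM, le_rfl⟩
        · exact ⟨hx, le_trans hxa had.le⟩
    have hnot : d ∉ M ∩ Set.Iic a := fun h => had.lt.not_ge h.2
    have hcard := Set.ncard_insert_of_notMem hnot (Set.toFinite _)
    have hpos : 0 < (M ∩ Set.Iic a).ncard :=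
      (Set.ncard_pos (Set.toFinite _)).2 ⟨a, haM, le_rfl⟩
    rw [← hconst a M hM haM, ← hconst d M hM hdM, hins, hcard]
    omega
  · have : C b ∩ Set.Iic b = {b} := by
      ext x
      constructor
      · rintro ⟨-, h1⟩
        exact le_antisymm h1 (hb x)
      · rintro rfl
        exact ⟨haC _, le_rfl⟩
    simp [this]
  · have : C t ∩ Set.Iic t = C t := by
      ext x
      exact ⟨fun h => h.1, fun h => ⟨h, ht x⟩⟩
    simp [this, hP _ (hC t)]

theorem IsGradedOfRank.isRankFn_posetRank {n : ℕ} (hP : IsGradedOfRank P n) (h01 : HasZeroOne P) :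
    IsRankFn (posetRank : P → ℕ) n := by
  obtain ⟨r, hr⟩ := hP.exists_isRankFn h01
  rwa [hr.posetRank_eq]

end Rank

/-! ### Alternating chain counts -/

open Classical in
/-- The alternating sum of the numbers of chains of given cardinality contained in `A`. -/
noncomputable def chainEuler {P : Type*} [PartialOrder P] (A : Finset P) : ℤ :=
  ∑ C ∈ A.powerset.filter fun C : Finset P => IsChain (· ≤ ·) (C : Set P),
    (-1) ^ C.card

section Euler

variable {P : Type*} [PartialOrder P]

theorem chainEuler_empty : chainEuler (∅ : Finset P) = 1 := by
  classical
  simp [chainEuler, Finset.filter_singleton]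

-- Removing `s` from a chain through `s` leaves a chain of elements comparable to `s`, and reverses
-- the sign.
open Classical in
theorem chainEuler_insert {s : P} {A : Finset P} (hs : s ∉ A) :
    chainEuler (insert s A) = chainEuler A - chainEuler {a ∈ A | a ≤ s ∨ s ≤ a} := by
  unfold chainEuler
  rw [Finset.powerset_insert, Finset.filter_union, Finset.sum_union, sub_eq_add_neg]
  · congr 1
    rw [← Finset.sum_neg_distrib]
    symm
    refine Finset.sum_bij (fun C _ => insert s C) ?_ ?_ ?_ ?_
    · intro C hC
      simp only [Finset.mem_filter, Finset.mem_powerset, Finset.mem_image] at hC ⊢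
      refine ⟨⟨C, fun x hx => (Finset.mem_filter.1 (hC.1 hx)).1, rfl⟩, ?_⟩
      rw [Finset.coe_insert]
      exact hC.2.insert fun b hb _ => (Finset.mem_filter.1 (hC.1 hb)).2.symm
    · intro C hC D hD hCD
      simp only [Finset.mem_filter, Finset.mem_powerset] at hC hD
      have h1 : s ∉ C := fun h => hs (Finset.mem_filter.1 (hC.1 h)).1
      have h2 : s ∉ D := fun h => hs (Finset.mem_filter.1 (hD.1 h)).1
      rw [← Finset.erase_insert h1, ← Finset.erase_insert h2, hCD]
    · intro D hD
      simp only [Finset.mem_filter, Finset.mem_powerset, Finset.mem_image] at hD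
      obtain ⟨⟨C, hC, rfl⟩, hch⟩ := hD
      refine ⟨C, ?_, rfl⟩
      simp only [Finset.mem_filter, Finset.mem_powerset]
      rw [Finset.coe_insert] at hch
      refine ⟨fun x hx => Finset.mem_filter.2 ⟨hC hx, ?_⟩, hch.mono (Set.subset_insert _ _)⟩
      exact hch.total (Set.mem_insert_of_mem _ hx) (Set.mem_insert _ _)
    · intro C hC
      simp only [Finset.mem_filter, Finset.mem_powerset] at hC
      have h1 : s ∉ C := fun h => hs (Finset.mem_filter.1 (hC.1 h)).1
      rw [Finset.card_insert_of_notMem h1, pow_succ]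
      ring
  · refine Finset.disjoint_filter_filter ?_
    rw [Finset.disjoint_left]
    intro C hC hC'
    simp only [Finset.mem_powerset, Finset.mem_image] at hC hC'
    obtain ⟨D, -, rfl⟩ := hC'
    exact hs (hC (Finset.mem_insert_self _ _))

/-- A set with an element comparable to all others is a cone. -/
theorem chainEuler_eq_zero_of_cone {c : P} {A : Finset P} (hc : c ∈ A)
    (h : ∀ a ∈ A, a ≤ c ∨ c ≤ a) : chainEuler A = 0 := by
  classical
  rw [← Finset.insert_erase hc, chainEuler_insert (Finset.notMem_erase c A),
    Finset.filter_true_of_mem, sub_self]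
  exact fun a ha => h a (Finset.mem_of_mem_erase ha)

end Euler

/-! ### Flag vectors and level sizes -/

section FlagVectors

variable {P : Type*} [PartialOrder P] [Fintype P]

open Classical in
theorem flagF_eq_card (S : Finset ℕ) : flagF P S =
    ({C : Finset P | IsChain (· ≤ ·) (C : Set P) ∧ C.image posetRank = S} :
      Finset (Finset P)).card := by
  unfold flagF
  rw [← Set.ncard_coe_finset]
  congr 1
  ext C
  simp

theorem IsRankFn.card_image_of_isChain {r : P → ℕ} {n : ℕ} (h : IsRankFn r n) {C : Finset P}
    (hC : IsChain (· ≤ ·) (C : Set P)) : (C.image r).card = C.card := by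
  refine Finset.card_image_of_injOn ?_
  intro a ha b hb hab
  rcases hC.total ha hb with h1 | h1
  · exact h.eq_of_le h1 hab
  · exact (h.eq_of_le h1 hab.symm).symm

/-- Group the chains by their rank set `T`. A chain has as many elements as ranks, so its sign
depends only on `T`, and `(-1) ^ (S \ T).card` differs from it by the factor `(-1) ^ S.card`. -/
theorem IsRankFn.flagH_eq_chainEuler {n : ℕ} (h : IsRankFn (posetRank : P → ℕ) n)
    (S : Finset ℕ) :
    flagH P S = (-1) ^ S.card * chainEuler ({a : P | posetRank a ∈ S} : Finset P) := by
  classical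
  have h1 : chainEuler ({a : P | posetRank a ∈ S} : Finset P) =
      ∑ T ∈ S.powerset, (-1) ^ T.card * (flagF P T : ℤ) := by
    unfold chainEuler
    rw [← Finset.sum_fiberwise_of_maps_to (g := fun C : Finset P => C.image posetRank) (t := S.powerset)]
    · refine Finset.sum_congr rfl fun T hT => ?_
      rw [Finset.mem_powerset] at hT
      rw [flagF_eq_card, mul_comm, ← nsmul_eq_mul, ← Finset.sum_const]
      refine Finset.sum_congr ?_ ?_
      · ext C
        simp only [Finset.mem_filter, Finset.mem_powerset, Finset.mem_univ, true_and]
        constructor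
        · rintro ⟨⟨-, h2⟩, h3⟩
          exact ⟨h2, h3⟩
        · rintro ⟨h2, h3⟩
          refine ⟨⟨fun x hx => ?_, h2⟩, h3⟩
          simp only [Finset.mem_filter, Finset.mem_univ, true_and]
          exact hT (h3 ▸ Finset.mem_image_of_mem _ hx)
      · intro C hC
        simp only [Finset.mem_filter, Finset.mem_univ, true_and] at hC
        rw [← hC.2, h.card_image_of_isChain hC.1]
    · intro C hC
      simp only [Finset.mem_filter, Finset.mem_powerset] at hC ⊢
      intro i hi
      obtain ⟨x, hx, rfl⟩ := Finset.mem_image.1 hi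
      exact (Finset.mem_filter.1 (hC.1 hx)).2
  rw [h1, flagH, Finset.mul_sum]
  refine Finset.sum_congr rfl fun T hT => ?_
  rw [Finset.mem_powerset] at hT
  rw [← mul_assoc, ← pow_add]
  congr 1
  have h2 := Finset.card_sdiff_add_card_eq_card hT
  rw [← h2, show (S \ T).card + T.card + T.card = (S \ T).card + 2 * T.card by ring, pow_add,
    pow_mul]
  simp

theorem IsRankFn.chainEuler_level {n : ℕ} {r : P → ℕ} (h : IsRankFn r n) (i : ℕ) :
    chainEuler ({a : P | r a = i} : Finset P) = 1 - (({a : P | r a = i} : Finset P).card : ℤ) := by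
  classical
  have key : ∀ A : Finset P, (∀ a ∈ A, r a = i) → chainEuler A = 1 - (A.card : ℤ) := by
    intro A
    induction A using Finset.induction_on with
    | empty => simp [chainEuler_empty]
    | insert a A ha ih =>
      intro hA
      rw [chainEuler_insert ha, ih fun b hb => hA b (Finset.mem_insert_of_mem hb),
        Finset.filter_false_of_mem, chainEuler_empty, Finset.card_insert_of_notMem ha]
      · push_cast; ring
      · intro b hb hab
        have h1 := hA b (Finset.mem_insert_of_mem hb)
        have h2 := hA a (Finset.mem_insert_self _ _)
        refine ha ?_
        rcases hab with h3 | h3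
        · rwa [← h.eq_of_le h3 (by omega)]
        · rwa [h.eq_of_le h3 (by omega)]
  exact key _ fun a ha => (Finset.mem_filter.1 ha).2

/-- Passing to the elements of `A` below an element of higher rank either changes nothing or
leaves a cone, when the top level of `A` has at most two elements. -/
theorem IsRankFn.chainEuler_below {n : ℕ} {r : P → ℕ} (h : IsRankFn r n)
    (hle : ∀ i, ({a : P | r a = i} : Finset P).card ≤ 2) (S : Finset ℕ) {s : P}
    (hs : ∀ i ∈ S, i < r s) {B : Finset P} (hB : ∀ a, a ∈ B ↔ r a ∈ S ∧ a ≤ s) :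
    chainEuler B = 0 ∨ chainEuler B = chainEuler ({a : P | r a ∈ S} : Finset P) := by
  classical
  rcases S.eq_empty_or_nonempty with rfl | hne
  · right
    congr 1
    ext a
    simp [hB]
  set i := S.max' hne with hi
  have hiS : i ∈ S := S.max'_mem hne
  by_cases hall : ∀ a, r a = i → a ≤ s
  · right
    congr 1
    ext a
    simp only [hB, Finset.mem_filter, Finset.mem_univ, true_and, and_iff_left_iff_imp]
    -- Every element with rank in `S` lies below some element of the top rank `i`, hence below `s`.
    intro ha
    obtain ⟨t, ht, rfl⟩ := h.top
    obtain ⟨c, hac, -, hc⟩ := h.exists_between (ht a) (i := i) (S.le_max' _ ha) (by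
      exact (hs i hiS).le.trans (h.monotone (ht s)))
    exact hac.trans (hall c hc)
  · left
    push Not at hall
    obtain ⟨d, hd, hds⟩ := hall
    obtain ⟨b, hb, hb0⟩ := h.bot
    obtain ⟨c, -, hcs, hc⟩ := h.exists_between (hb s) (i := i) (by omega) (hs i hiS).le
    -- Since `d` is not below `s`, only one element `c` of rank `i` is; it will be the cone point.
    have huniq : ∀ e, r e = i → e ≤ s → e = c := by
      intro e he hes
      by_contra hec
      have hsub : ({c, d, e} : Finset P) ⊆ ({a : P | r a = i} : Finset P) := by
        intro x hx
        simp only [Finset.mem_insert, Finset.mem_singleton] at hx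
        rcases hx with rfl | rfl | rfl <;> simp [*]
      have hcard : ({c, d, e} : Finset P).card = 3 := by
        refine Finset.card_eq_three.2 ⟨c, d, e, ?_, Ne.symm hec, ?_, rfl⟩
        · rintro rfl; exact hds hcs
        · rintro rfl; exact hds hes
      have := Finset.card_le_card hsub
      have := hle i
      omega
    refine chainEuler_eq_zero_of_cone ((hB c).2 ⟨hc ▸ hiS, hcs⟩) fun a ha => ?_
    obtain ⟨haS, has⟩ := (hB a).1 ha
    obtain ⟨e, hae, hes, he⟩ := h.exists_between has (i := i) (S.le_max' _ haS) (hs i hiS).le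
    exact Or.inl (huniq e he hes ▸ hae)

/-- Each element of the top rank subtracts either 0 or the value for the remaining ranks, and there
are at most two such elements. -/
theorem IsRankFn.chainEuler_rankSelected {n : ℕ} {r : P → ℕ} (h : IsRankFn r n)
    (hle : ∀ i, ({a : P | r a = i} : Finset P).card ≤ 2) (S : Finset ℕ) :
    chainEuler ({a : P | r a ∈ S} : Finset P) = 0 ∨
      chainEuler ({a : P | r a ∈ S} : Finset P) = 1 ∨
      chainEuler ({a : P | r a ∈ S} : Finset P) = -1 := by
  classical
  induction S using Finset.induction_on_max with
  | empty => simp [chainEuler_empty]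
  | insert j S hj ih =>
  set A : Finset P := {a : P | r a ∈ S} with hA
  have hun : ({a : P | r a ∈ insert j S} : Finset P) = ({a : P | r a = j} : Finset P) ∪ A := by
    ext a
    simp [hA]
  rw [hun]
  have hmemA : ∀ a, a ∈ A ↔ r a ∈ S := fun a => by simp [hA]
  have hnot : ∀ s, r s = j → s ∉ A := fun s hs hsA =>
    absurd (hj _ ((hmemA s).1 hsA)) (by omega)
  have hbelow : ∀ s, r s = j → ∀ B : Finset P, (∀ a, a ∈ B ↔ r a ∈ S ∧ a ≤ s) →
      chainEuler B = 0 ∨ chainEuler B = chainEuler A := fun s hs B hB =>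
    h.chainEuler_below hle S (fun i hi => hs ▸ hj i hi) hB
  have hcomp : ∀ s a, r s = j → r a ∈ S → (a ≤ s ∨ s ≤ a ↔ a ≤ s) := fun s a hs ha => by
    refine ⟨fun h1 => h1.resolve_right fun h2 => ?_, Or.inl⟩
    have := h.monotone h2
    have := hj _ ha
    omega
  have hlj := hle j
  interval_cases hc : ({a : P | r a = j} : Finset P).card
  · rw [Finset.card_eq_zero] at hc
    rwa [hc, Finset.empty_union]
  · obtain ⟨s, hs⟩ := Finset.card_eq_one.1 hc
    have hsj : r s = j := by
      have : s ∈ ({a : P | r a = j} : Finset P) := by simp [hs]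
      simpa using this
    rw [hs, Finset.singleton_union, chainEuler_insert (hnot s hsj)]
    have := hbelow s hsj {a ∈ A | a ≤ s ∨ s ≤ a} fun a => by
      rw [Finset.mem_filter, hmemA]
      exact and_congr_right fun ha => hcomp s a hsj ha
    omega
  · obtain ⟨s, t, hst, hs⟩ := Finset.card_eq_two.1 hc
    have hsj : r s = j := by
      have : s ∈ ({a : P | r a = j} : Finset P) := by simp [hs]
      simpa using this
    have htj : r t = j := by
      have : t ∈ ({a : P | r a = j} : Finset P) := by simp [hs]
      simpa using this
    have hsnot : s ∉ insert t A := by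
      rw [Finset.mem_insert]
      exact fun h1 => h1.elim hst (hnot s hsj)
    rw [hs, Finset.insert_union, Finset.singleton_union, chainEuler_insert hsnot,
      chainEuler_insert (hnot t htj)]
    have h1 := hbelow t htj {a ∈ A | a ≤ t ∨ t ≤ a} fun a => by
      rw [Finset.mem_filter, hmemA]
      exact and_congr_right fun ha => hcomp t a htj ha
    -- The elements `s` and `t` have equal rank and are incomparable, so `t` does not affect the
    -- term subtracted for `s`.
    have h2 := hbelow s hsj {a ∈ insert t A | a ≤ s ∨ s ≤ a} fun a => by
      rw [Finset.mem_filter, Finset.mem_insert, hmemA]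
      constructor
      · rintro ⟨rfl | ha, h3⟩
        · exact absurd (h3.elim (fun h4 => (h.eq_of_le h4 (by omega)).symm)
            fun h4 => h.eq_of_le h4 (by omega)) hst
        · exact ⟨ha, (hcomp s a hsj ha).1 h3⟩
      · rintro ⟨ha, h3⟩
        exact ⟨Or.inr ha, Or.inl h3⟩
    omega

/-- A graded poset with `0̂` and `1̂` has a multiplicity-free flag `h`-vector if and only if no
rank contains more than two elements. -/
theorem IsRankFn.flagHMultiplicityFree_iff {n : ℕ} {r : P → ℕ} (h : IsRankFn r n) :
    FlagHMultiplicityFree P n ↔ ∀ i, ({a : P | r a = i} : Finset P).card ≤ 2 := by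
  classical
  have hr := h.posetRank_eq
  subst hr
  constructor
  · intro hMF i
    by_cases hi : i ∈ Finset.Ico 1 n
    · have h1 := hMF {i} (by simpa using hi)
      have h2 := h.flagH_eq_chainEuler {i}
      simp only [Finset.mem_singleton, Finset.card_singleton, pow_one, h.chainEuler_level] at h2
      omega
    -- Ranks 0 and `n` have one element each, and ranks above `n` have none.
    · refine le_trans (Finset.card_le_one.2 fun a ha b hb => ?_) one_le_two
      simp only [Finset.mem_filter, Finset.mem_univ, true_and] at ha hb
      rw [Finset.mem_Ico] at hi
      have := h.le a
      rcases Nat.eq_zero_or_pos i with h0 | h0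
      · exact h.eq_of_rank_eq_zero (by omega) (by omega)
      · exact h.eq_of_rank_eq_top (by omega) (by omega)
  · intro hle S _
    rw [h.flagH_eq_chainEuler S]
    rcases neg_one_pow_eq_or ℤ S.card with h1 | h1 <;> rw [h1] <;>
      have := h.chainEuler_rankSelected hle S <;> omega

end FlagVectors

/-! ### Steps between levels -/

/-- The ways of adding a level with one or two elements on top of a graded poset. The elements of
a level are labelled by booleans; `zig c` relates all pairs except for `c` and `true`. -/
inductive LevelStep
  | point
  | full
  | parallel
  | zig (c : Bool)
  deriving DecidableEq, Fintype

/-- The kind of a level: it has one element, or two elements that are exchanged by an automorphism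
of the part of the poset below it, or two elements that are not. -/
inductive LevelKind
  | single
  | sym
  | asym
  deriving DecidableEq

instance : Fintype LevelKind where
  elems := {.single, .sym, .asym}
  complete q := by cases q <;> simp

namespace LevelKind

/-- The labels of the elements of a level. -/
def labels : LevelKind → Finset Bool
  | single => {false}
  | _ => Finset.univ

/-- The kind of the level added by a step. -/
def next (q : LevelKind) : LevelStep → LevelKind
  | .point => single
  -- Exchanging the two new elements fixes everything below them.
  | .full => sym
  -- Exchanges of the two pairs correspond under the matching.
  | .parallel => q
  -- The two new elements have different numbers of lower covers.
  | .zig _ => asym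

/-- The steps used above a level of a given kind in the normal form of a poset. -/
def allowed : LevelKind → LevelStep → Bool
  | _, .point => true
  | _, .full => true
  -- Two elements above a single one are always both related to it, which is already `full`.
  | single, _ => false
  | _, .parallel => true
  | _, .zig true => true
  -- The exchange of the lower pair turns this step into `zig true`.
  | sym, .zig false => false
  | asym, .zig false => true

/-- The kind of the `i`-th level when the steps `w` are applied to a level of kind `q`. -/
def level (q : LevelKind) (w : ℕ → LevelStep) : ℕ → LevelKind
  | 0 => q
  | i + 1 => (level q w i).next (w i)

theorem level_congr {q : LevelKind} {w w' : ℕ → LevelStep} {i : ℕ} (h : ∀ j < i, w j = w' j) :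
    q.level w i = q.level w' i := by
  induction i with
  | zero => rfl
  | succ i ih =>
    rw [level, level, ih fun j hj => h j (hj.trans (Nat.lt_succ_self i)), h i (Nat.lt_succ_self i)]

end LevelKind

/-- The order relation between the labels of two adjacent levels. -/
def LevelStep.rel : LevelStep → Bool → Bool → Bool
  | point, _, _ => true
  | full, _, _ => true
  | parallel, a, b => a == b
  | zig c, a, b => !(a == c && b)

/-- Together with `exists_rel_above`, this ensures that the poset built from a word has a least and
a greatest element. -/
theorem LevelStep.exists_rel_below : ∀ (q : LevelKind) (l : LevelStep), q.allowed l = true →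
    ∀ b ∈ (q.next l).labels, ∃ a ∈ q.labels, l.rel a b = true := by
  decide

theorem LevelStep.exists_rel_above : ∀ (q : LevelKind) (l : LevelStep), q.allowed l = true →
    ∀ a ∈ q.labels, ∃ b ∈ (q.next l).labels, l.rel a b = true := by
  decide

/-- Relabelling two adjacent levels cannot change an allowed step into another one, and it can
only exchange the elements of an `asym` level trivially. -/
theorem LevelStep.eq_of_rel_eq : ∀ (q : LevelKind) (l l' : LevelStep) (s s' : Bool),
    q.allowed l = true → q.allowed l' = true → (q.next l).labels = Finset.univ →
    (q.next l').labels = Finset.univ → (s = true → q = .sym) →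
    (∀ a ∈ q.labels, ∀ b, l.rel a b = l'.rel (xor s a) (xor s' b)) →
    l = l' ∧ (s' = true → q.next l = .sym) := by
  decide

/-- Every relation between two levels without isolated elements becomes an allowed step after a
suitable relabelling. -/
theorem LevelStep.exists_normalForm : ∀ (q : LevelKind) (r₁ r₂ r₃ r₄ : Bool),
    let R : Bool → Bool → Bool := fun a b => bif a then (bif b then r₁ else r₂) else
      (bif b then r₃ else r₄)
    (∀ a ∈ q.labels, ∃ b, R a b = true) → (∀ b, ∃ a ∈ q.labels, R a b = true) →
    ∃ l : LevelStep, q.allowed l = true ∧ (q.next l).labels = Finset.univ ∧ ∃ t : Bool,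
      -- The relabelling `t` is fixed first. Each exchange `s'` permitted on the new level must then
      -- be matched by a permitted exchange `s` below it.
      ∀ s' : Bool, (s' = true → q.next l = .sym) → ∃ s : Bool, (s = true → q = .sym) ∧
        ∀ a ∈ q.labels, ∀ b, R (xor s a) (xor t (xor s' b)) = l.rel a b := by
  decide

/-! ### Labellings and uniqueness of the normal form -/

/-- The labelling `L` exhibits the part of rank at most `i` of a poset with rank function `r` as
the poset built from one element by the steps `w`. -/
structure IsLabelling {P : Type*} [PartialOrder P] (r : P → ℕ) (w : ℕ → LevelStep) (i : ℕ)
    (L : P → Bool) : Prop where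
  inj : ∀ ⦃a b : P⦄, r a = r b → r a ≤ i → L a = L b → a = b
  labels : ∀ j ≤ i, ∀ b, b ∈ (LevelKind.single.level w j).labels ↔ ∃ a, r a = j ∧ L a = b
  covBy : ∀ ⦃a b : P⦄, r a < i → r b = r a + 1 → (a ⋖ b ↔ (w (r a)).rel (L a) (L b) = true)

/-- Validity of the first `n` steps of `w`. -/
def IsNormalForm (q : LevelKind) (w : ℕ → LevelStep) (n : ℕ) : Prop :=
  ∀ j < n, (q.level w j).allowed (w j) = true

namespace IsLabelling

variable {P : Type*} [PartialOrder P] {r : P → ℕ} {w : ℕ → LevelStep} {i n : ℕ} {L : P → Bool}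

theorem congr {w' : ℕ → LevelStep} (h : IsLabelling r w i L) (hw : ∀ j < i, w j = w' j) :
    IsLabelling r w' i L where
  inj := h.inj
  labels j hj := by
    rw [← LevelKind.level_congr fun k hk => hw k (hk.trans_le hj)]
    exact h.labels j hj
  covBy a b ha hb := by
    rw [← hw _ ha]
    exact h.covBy ha hb

theorem image_eq (h : IsLabelling r w n L) (hi : i ≤ n) :
    L '' {a | r a = i} = (LevelKind.single.level w i).labels := by
  ext b
  rw [Finset.mem_coe, h.labels i hi]
  rfl

theorem injOn (h : IsLabelling r w n L) (hi : i ≤ n) : Set.InjOn L {a | r a = i} :=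
  fun _ ha _ hb hab => h.inj (ha.trans hb.symm) (ha.le.trans hi) hab

theorem card_eq [Fintype P] (h : IsLabelling r w n L) (hr : IsRankFn r n) :
    Fintype.card P = ∑ i ∈ Finset.range (n + 1), (LevelKind.single.level w i).labels.card := by
  classical
  rw [← Finset.card_univ, Finset.card_eq_sum_card_fiberwise (f := r) (t := Finset.range (n + 1))]
  · refine Finset.sum_congr rfl fun i hi => ?_
    have hi' : i ≤ n := by simpa [Nat.lt_succ_iff] using hi
    rw [← Set.ncard_coe_finset, ← Set.ncard_coe_finset, ← h.image_eq hi',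
      (h.injOn hi').ncard_image]
    congr 1
    ext a
    simp
  · intro a _
    simpa [Nat.lt_succ_iff] using hr.le a

/-- The elements of a poset with a labelling correspond to its ranks and labels. -/
theorem bijective (h : IsLabelling r w n L) (hr : IsRankFn r n) [Finite P] :
    Function.Bijective (fun a : P => (⟨(r a, L a), hr.le a,
      (h.labels _ (hr.le a) _).2 ⟨a, rfl, rfl⟩⟩ :
        {p : ℕ × Bool // p.1 ≤ n ∧ p.2 ∈ (LevelKind.single.level w p.1).labels})) := by
  constructor
  · intro a b hab
    rw [Subtype.mk.injEq, Prod.mk.injEq] at hab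
    exact h.inj hab.1 (hr.le a) hab.2
  · rintro ⟨⟨i, b⟩, hi, hb⟩
    obtain ⟨a, rfl, rfl⟩ := (h.labels i hi b).1 hb
    exact ⟨a, rfl⟩

end IsLabelling

theorem nonempty_orderIso_of_covBy_iff {P Q : Type*} [PartialOrder P] [PartialOrder Q] [Finite P]
    [Finite Q] (e : P ≃ Q) (he : ∀ a b, e a ⋖ e b ↔ a ⋖ b) : Nonempty (P ≃o Q) := by
  refine ⟨⟨e, fun {a b} => ?_⟩⟩
  rw [le_iff_reflTransGen_covBy_of_finite, le_iff_reflTransGen_covBy_of_finite]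
  constructor
  · intro h
    have := Relation.ReflTransGen.lift (p := (· ⋖ ·)) e.symm
      (fun x y (hxy : x ⋖ y) => show e.symm x ⋖ e.symm y by rw [← he]; simpa using hxy) _ _ h
    simpa [Function.onFun] using this
  · exact fun h => Relation.ReflTransGen.lift e (fun x y hxy => (he x y).2 hxy) _ _ h

/-- Posets with labellings by the same word are isomorphic. -/
theorem IsLabelling.nonempty_orderIso {P Q : Type*} [PartialOrder P] [PartialOrder Q] [Finite P]
    [Finite Q] {r : P → ℕ} {r' : Q → ℕ} {w : ℕ → LevelStep} {n : ℕ} {L : P → Bool} {L' : Q → Bool}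
    (hr : IsRankFn r n) (hr' : IsRankFn r' n) (h : IsLabelling r w n L)
    (h' : IsLabelling r' w n L') : Nonempty (P ≃o Q) := by
  set e := (Equiv.ofBijective _ (h.bijective hr)).trans
    (Equiv.ofBijective _ (h'.bijective hr')).symm with he
  have key : ∀ a, r' (e a) = r a ∧ L' (e a) = L a := fun a => by
    have h1 : Equiv.ofBijective _ (h'.bijective hr') (e a) =
        Equiv.ofBijective _ (h.bijective hr) a := by simp [he]
    simpa [Equiv.ofBijective_apply] using h1
  refine nonempty_orderIso_of_covBy_iff e fun a b => ?_
  by_cases hab : r b = r a + 1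
  · have ha : r a < n := by have := hr.le b; omega
    rw [h.covBy ha hab, h'.covBy (by rwa [(key a).1]) (by rw [(key a).1, (key b).1, hab]),
      (key a).1, (key a).2, (key b).2]
  · refine ⟨fun h1 => absurd (hr'.covBy h1) ?_, fun h1 => absurd (hr.covBy h1) hab⟩
    rwa [(key a).1, (key b).1]

/-- Two labellings of one level differ by a permutation of the labels, and a permutation of `Bool`
is `xor` with a constant. -/
theorem LevelKind.exists_xor_of_image_eq {P : Type*} {X : Set P} {f g : P → Bool}
    {q q' : LevelKind} (hf : Set.InjOn f X) (hg : Set.InjOn g X) (hfq : f '' X = q.labels)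
    (hgq : g '' X = q'.labels) :
    q.labels = q'.labels ∧
      ∃ s : Bool, (s = true → q.labels = Finset.univ) ∧ ∀ a ∈ X, g a = xor s (f a) := by
  have hcard : q.labels.card = q'.labels.card := by
    rw [← Set.ncard_coe_finset, ← Set.ncard_coe_finset, ← hfq, ← hgq, hf.ncard_image,
      hg.ncard_image]
  have hlab : ∀ q q' : LevelKind, q.labels.card = q'.labels.card → q.labels = q'.labels := by
    decide
  have hor : ∀ q : LevelKind, q.labels = {false} ∨ q.labels = Finset.univ := by decide
  refine ⟨hlab _ _ hcard, ?_⟩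
  rcases hor q with hq | hq
  · refine ⟨false, by simp, fun a ha => ?_⟩
    have h1 : f a ∈ (q.labels : Set Bool) := hfq ▸ Set.mem_image_of_mem f ha
    have h2 : g a ∈ (q'.labels : Set Bool) := hgq ▸ Set.mem_image_of_mem g ha
    rw [← hlab _ _ hcard, hq] at h2
    rw [hq] at h1
    simp only [Finset.coe_singleton, Set.mem_singleton_iff] at h1 h2
    simp [h1, h2]
  · have h0 : false ∈ f '' X := by rw [hfq, hq]; simp
    obtain ⟨a₀, ha₀, h0⟩ := h0
    refine ⟨g a₀, fun _ => hq, fun a ha => ?_⟩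
    cases hfa : f a with
    | false => rw [hf ha ha₀ (hfa.trans h0.symm)]; simp
    | true =>
      have hne : g a ≠ g a₀ := fun h1 => by
        have := hg ha ha₀ h1
        subst this
        simp [hfa] at h0
      rw [Bool.xor_true]
      exact Bool.eq_not.2 hne

theorem LevelStep.eq_point : ∀ (q : LevelKind) (l : LevelStep), q.allowed l = true →
    (q.next l).labels ≠ Finset.univ → l = .point := by
  decide

/-- A poset has at most one normal form. -/
theorem IsLabelling.eq_of_isNormalForm {P : Type*} [PartialOrder P] {r : P → ℕ}
    {w w' : ℕ → LevelStep} {n : ℕ} {L L' : P → Bool} (h : IsLabelling r w n L)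
    (h' : IsLabelling r w' n L') (hw : IsNormalForm .single w n)
    (hw' : IsNormalForm .single w' n) : ∀ j < n, w j = w' j := by
  -- The induction must also track how the labellings differ: they may be exchanged on level `i`
  -- only if its kind is `sym`.
  suffices H : ∀ i ≤ n, (∀ j < i, w j = w' j) ∧
      ∃ s : Bool, (s = true → LevelKind.single.level w i = .sym) ∧
        ∀ a, r a = i → L' a = xor s (L a) from (H n le_rfl).1
  intro i
  induction i with
  | zero =>
    refine fun _ => ⟨by simp, false, by simp, fun a ha => ?_⟩
    have h1 := (h.labels 0 (Nat.zero_le n) (L a)).2 ⟨a, ha, rfl⟩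
    have h2 := (h'.labels 0 (Nat.zero_le n) (L' a)).2 ⟨a, ha, rfl⟩
    simp only [LevelKind.level, LevelKind.labels, Finset.mem_singleton] at h1 h2
    simp [h1, h2]
  | succ i ih =>
    intro hi
    obtain ⟨hlt, s, hs, hL⟩ := ih (by omega)
    have hq : LevelKind.single.level w' i = LevelKind.single.level w i :=
      (LevelKind.level_congr hlt).symm
    have ha := hw i hi
    have ha' := hw' i hi
    obtain ⟨hlab, s', hs', hL'⟩ := LevelKind.exists_xor_of_image_eq (h.injOn hi) (h'.injOn hi)
      (h.image_eq hi) (h'.image_eq hi)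
    rw [LevelKind.level, LevelKind.level, hq] at hlab
    rw [LevelKind.level] at hs'
    rw [hq] at ha'
    suffices H : w i = w' i ∧ (s' = true → (LevelKind.single.level w i).next (w i) = .sym) by
      refine ⟨fun j hj => ?_, s', H.2, hL'⟩
      rcases Nat.lt_succ_iff_lt_or_eq.1 hj with h1 | rfl
      · exact hlt j h1
      · exact H.1
    by_cases huniv : ((LevelKind.single.level w i).next (w i)).labels = Finset.univ
    · refine LevelStep.eq_of_rel_eq _ _ _ s s' ha ha' huniv (hlab ▸ huniv) hs fun a haq b => ?_
      obtain ⟨x, hx, rfl⟩ := (h.labels i (by omega) a).1 haq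
      obtain ⟨y, hy, rfl⟩ := (h.labels (i + 1) hi b).1 (by
        rw [LevelKind.level, huniv]; exact Finset.mem_univ b)
      have h1 := h.covBy (a := x) (b := y) (by omega) (by omega)
      have h2 := h'.covBy (a := x) (b := y) (by omega) (by omega)
      rw [← hL x hx, ← hL' y hy, Bool.eq_iff_iff]
      rw [hx] at h1 h2
      exact h1.symm.trans h2
    · refine ⟨?_, fun h1 => absurd (hs' h1) huniv⟩
      rw [LevelStep.eq_point _ _ ha huniv, LevelStep.eq_point _ _ ha' (hlab ▸ huniv)]

/-! ### Existence of the normal form -/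

theorem IsLabelling.extend {P : Type*} [PartialOrder P] {r : P → ℕ} {w : ℕ → LevelStep} {i : ℕ}
    {L g : P → Bool} (h : IsLabelling r w i L) {l : LevelStep}
    (hinj : Set.InjOn g {a | r a = i + 1})
    (himg : ∀ b, b ∈ ((LevelKind.single.level w i).next l).labels ↔ ∃ a, r a = i + 1 ∧ g a = b)
    (hcov : ∀ a b, r a = i → r b = i + 1 → (a ⋖ b ↔ l.rel (L a) (g b) = true)) :
    IsLabelling r (Function.update w i l) (i + 1) (fun a => if r a ≤ i then L a else g a) := by
  have hlevel : ∀ j ≤ i, LevelKind.single.level (Function.update w i l) j =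
      LevelKind.single.level w j := fun j hj =>
    LevelKind.level_congr fun k hk => Function.update_of_ne (by omega) _ _
  refine ⟨fun a b hab ha hL => ?_, fun j hj b => ?_, fun a b ha hab => ?_⟩
  · simp only [← hab] at hL
    split_ifs at hL with h1
    · exact h.inj hab h1 hL
    · exact hinj (show r a = i + 1 by omega) (show r b = i + 1 by omega) hL
  · rcases Nat.le_succ_iff.1 hj with h1 | rfl
    · rw [hlevel j h1, h.labels j h1]
      refine exists_congr fun a => and_congr_right fun ha => ?_
      rw [if_pos (by omega)]
    · rw [LevelKind.level, hlevel i le_rfl, Function.update_self, himg]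
      refine exists_congr fun a => and_congr_right fun ha => ?_
      rw [if_neg (by omega)]
  · rcases Nat.lt_succ_iff_lt_or_eq.1 ha with h1 | h1
    · rw [Function.update_of_ne (by omega), if_pos (by omega), if_pos (by omega), h.covBy h1 hab]
    · rw [h1, Function.update_self, if_pos le_rfl, if_neg (by omega), hcov a b h1 (by omega)]

theorem IsNormalForm.extend {w : ℕ → LevelStep} {i : ℕ} {q : LevelKind}
    (hw : IsNormalForm q w i) {l : LevelStep} (hl : (q.level w i).allowed l = true) :
    IsNormalForm q (Function.update w i l) (i + 1) := by
  intro j hj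
  have hlevel : ∀ j ≤ i, q.level (Function.update w i l) j = q.level w j := fun j hj =>
    LevelKind.level_congr fun k hk => Function.update_of_ne (by omega) _ _
  rw [hlevel j (by omega)]
  rcases Nat.lt_succ_iff_lt_or_eq.1 hj with h1 | rfl
  · rw [Function.update_of_ne (by omega)]
    exact hw j h1
  · rwa [Function.update_self]

/-- Every graded poset with at most two elements of each rank has a normal form. -/
theorem IsRankFn.exists_isLabelling {P : Type*} [PartialOrder P] [Fintype P] {r : P → ℕ} {n : ℕ}
    (hr : IsRankFn r n) (hle : ∀ i, ({a : P | r a = i} : Finset P).card ≤ 2) :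
    ∃ w L, IsNormalForm .single w n ∧ IsLabelling r w n L := by
  classical
  -- The strengthening encodes the automorphism behind `sym`: on such a level both `f` and its
  -- exchange come from labellings by the same word. The choice of `L` is thus postponed until the
  -- next step is known.
  suffices H : ∀ i ≤ n, ∃ w, IsNormalForm .single w i ∧ ∃ f : P → Bool,
      ∀ s : Bool, (s = true → LevelKind.single.level w i = .sym) →
        ∃ L, IsLabelling r w i L ∧ ∀ a, r a = i → f a = xor s (L a) by
    obtain ⟨w, hw, f, hf⟩ := H n le_rfl
    obtain ⟨L, hL, -⟩ := hf false (by simp)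
    exact ⟨w, L, hw, hL⟩
  intro i
  induction i with
  | zero =>
    refine fun _ => ⟨fun _ => .point, fun j hj => absurd hj (by omega), fun _ => false,
      fun s hs => ⟨fun _ => false, ⟨fun a b hab ha _ => ?_, fun j hj b => ?_, ?_⟩, ?_⟩⟩
    · exact hr.eq_of_rank_eq_zero (by omega) (by omega)
    · obtain rfl : j = 0 := by omega
      obtain ⟨a, ha⟩ := hr.exists_rank_eq (Nat.zero_le n)
      simp only [LevelKind.level, LevelKind.labels, Finset.mem_singleton]
      exact ⟨fun h => ⟨a, ha, h.symm⟩, fun ⟨_, _, h⟩ => h.symm⟩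
    · intro a b ha
      omega
    · intro a _
      cases s
      · rfl
      · simp [LevelKind.level] at hs
  | succ i ih =>
    intro hi
    obtain ⟨w, hw, f, hf⟩ := ih (by omega)
    obtain ⟨L₀, hL₀, hfL₀⟩ := hf false (by simp)
    simp only [Bool.false_xor] at hfL₀
    have hlevel : ∀ l, LevelKind.single.level (Function.update w i l) (i + 1) =
        (LevelKind.single.level w i).next l := fun l => by
      rw [LevelKind.level, Function.update_self,
        LevelKind.level_congr fun k hk => Function.update_of_ne (by omega) _ _]
    have hcard := hle (i + 1)
    interval_cases hc : ({a : P | r a = i + 1} : Finset P).card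
    · obtain ⟨a, ha⟩ := hr.exists_rank_eq hi
      rw [Finset.card_eq_zero] at hc
      have : a ∈ ({a : P | r a = i + 1} : Finset P) := by simp [ha]
      simp [hc] at this
    · obtain ⟨x, hx⟩ := Finset.card_eq_one.1 hc
      have hmem : ∀ a, r a = i + 1 ↔ a = x := fun a => by
        have : a ∈ ({a : P | r a = i + 1} : Finset P) ↔ a ∈ ({x} : Finset P) := by rw [hx]
        simpa using this
      have hal : (LevelKind.single.level w i).allowed .point = true := by
        cases LevelKind.single.level w i <;> rfl
      refine ⟨_, hw.extend hal, fun _ => false, fun s hs => ?_⟩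
      obtain rfl : s = false := by
        cases s
        · rfl
        · rw [hlevel] at hs
          simp [LevelKind.next] at hs
      refine ⟨_, hL₀.extend (g := fun _ => false) ?_ ?_ ?_, fun a ha => ?_⟩
      · intro a ha b hb _
        rw [(hmem a).1 ha, (hmem b).1 hb]
      · intro b
        simp only [LevelKind.next, LevelKind.labels, Finset.mem_singleton]
        exact ⟨fun h => ⟨x, (hmem x).2 rfl, h.symm⟩, fun ⟨_, _, h⟩ => h.symm⟩
      · intro a b ha hb
        refine ⟨fun _ => rfl, fun _ => ?_⟩
        obtain ⟨c, hac, hc⟩ := hr.exists_covBy_above (a := a) (by omega)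
        rw [ha] at hc
        rwa [(hmem b).1 hb, ← (hmem c).1 hc]
      · rw [if_neg (by omega)]
        rfl
    · obtain ⟨x, y, hxy, hx⟩ := Finset.card_eq_two.1 hc
      have hmem : ∀ a, r a = i + 1 ↔ a = x ∨ a = y := fun a => by
        have : a ∈ ({a : P | r a = i + 1} : Finset P) ↔ a ∈ ({x, y} : Finset P) := by rw [hx]
        simpa using this
      set g : P → Bool := fun a => decide (a = y) with hg
      have hgx : g x = false := by simp [hg, hxy]
      have hgy : g y = true := by simp [hg]
      have hginj : ∀ a b, r a = i + 1 → r b = i + 1 → g a = g b → a = b := by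
        intro a b ha hb hab
        rcases (hmem a).1 ha with rfl | rfl <;> rcases (hmem b).1 hb with rfl | rfl <;>
          simp_all
      have hgsurj : ∀ b, ∃ a, r a = i + 1 ∧ g a = b := by
        intro b
        cases b
        · exact ⟨x, (hmem x).2 (Or.inl rfl), hgx⟩
        · exact ⟨y, (hmem y).2 (Or.inr rfl), hgy⟩
      -- `R` is the cover relation between the two levels, read through the provisional labels `f`
      -- and `g`.
      set R : Bool → Bool → Bool := fun a b =>
        decide (∃ u v, r u = i ∧ f u = a ∧ r v = i + 1 ∧ g v = b ∧ u ⋖ v) with hR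
      have hRiff : ∀ u v, r u = i → r v = i + 1 → (u ⋖ v ↔ R (f u) (g v) = true) := by
        intro u v hu hv
        simp only [hR, decide_eq_true_eq]
        refine ⟨fun h => ⟨u, v, hu, rfl, hv, rfl, h⟩, ?_⟩
        rintro ⟨u', v', hu', hfu, hv', hgv, h⟩
        rw [hfL₀ u hu, hfL₀ u' hu'] at hfu
        rwa [← hL₀.inj (hu'.trans hu.symm) hu'.le hfu, ← hginj v' v hv' hv hgv]
      obtain ⟨l, hal, huniv, t, H⟩ := LevelStep.exists_normalForm (LevelKind.single.level w i)
        (R true true) (R true false) (R false true) (R false false)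
        (by
          intro a ha
          obtain ⟨u, hu, rfl⟩ := (hL₀.labels i le_rfl a).1 ha
          obtain ⟨v, huv, hv⟩ := hr.exists_covBy_above (a := u) (by omega)
          refine ⟨g v, ?_⟩
          have := (hRiff u v hu (by omega)).1 huv
          rw [hfL₀ u hu] at this
          revert this
          cases L₀ u <;> cases g v <;> exact id)
        (by
          intro b
          obtain ⟨v, hv, rfl⟩ := hgsurj b
          obtain ⟨u, huv, hu⟩ := hr.exists_covBy_below hv
          refine ⟨L₀ u, (hL₀.labels i le_rfl _).2 ⟨u, hu, rfl⟩, ?_⟩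
          have := (hRiff u v hu hv).1 huv
          rw [hfL₀ u hu] at this
          revert this
          cases L₀ u <;> cases g v <;> exact id)
      refine ⟨_, hw.extend hal, fun a => xor t (g a), fun s' hs' => ?_⟩
      rw [hlevel] at hs'
      -- Only now is the lower labelling selected, with the exchange `s` that the requested `s'`
      -- needs.
      obtain ⟨s, hs, Hs⟩ := H s' hs'
      obtain ⟨L, hL, hfL⟩ := hf s hs
      refine ⟨_, hL.extend (g := fun a => xor s' (xor t (g a))) ?_ ?_ ?_, fun a ha => ?_⟩
      · intro a ha b hb hab
        exact hginj a b ha hb (by simpa using hab)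
      · intro b
        rw [huniv]
        refine ⟨fun _ => ?_, fun _ => Finset.mem_univ b⟩
        obtain ⟨a, ha, hab⟩ := hgsurj (xor t (xor s' b))
        exact ⟨a, ha, by rw [hab]; simp⟩
      · intro u v hu hv
        have h1 := Hs (L u) ((hL.labels i le_rfl _).2 ⟨u, hu, rfl⟩) (xor s' (xor t (g v)))
        rw [hRiff u v hu hv, ← h1, hfL u hu]
        have h2 : xor t (xor s' (xor s' (xor t (g v)))) = g v := by simp
        rw [h2]
        cases xor s (L u) <;> cases g v <;> rfl
      · rw [if_neg (by omega)]
        simp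

/-! ### The poset built from a word -/

/-- The ranks and labels of the elements of the poset built by the first `n` steps of `w`. -/
@[ext]
structure LevelElement (w : ℕ → LevelStep) (n : ℕ) where
  rank : ℕ
  label : Bool
  rank_le : rank ≤ n
  label_mem : label ∈ (LevelKind.single.level w rank).labels

namespace LevelElement

variable {w : ℕ → LevelStep} {n : ℕ}

instance : Finite (LevelElement w n) :=
  Finite.of_injective
    (fun p => ((⟨p.rank, Nat.lt_succ_of_le p.rank_le⟩ : Fin (n + 1)), p.label)) fun p q h => by
      simp only [Prod.mk.injEq, Fin.mk.injEq] at h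
      exact LevelElement.ext h.1 h.2

/-- The relation between the elements of adjacent levels. -/
def Adj (p q : LevelElement w n) : Prop :=
  q.rank = p.rank + 1 ∧ (w p.rank).rel p.label q.label = true

theorem rank_le_of_reflTransGen {p q : LevelElement w n} (h : Relation.ReflTransGen Adj p q) :
    p = q ∨ p.rank < q.rank := by
  induction h with
  | refl => exact Or.inl rfl
  | tail _ hbc ih =>
    right
    rcases ih with rfl | ih
    · rw [hbc.1]; omega
    · rw [hbc.1]; omega

/-- The order generated by the relations between adjacent levels. -/
instance : PartialOrder (LevelElement w n) where
  le := Relation.ReflTransGen Adj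
  le_refl _ := Relation.ReflTransGen.refl
  le_trans _ _ _ := Relation.ReflTransGen.trans
  le_antisymm p q hpq hqp := by
    rcases rank_le_of_reflTransGen hpq with h1 | h1
    · exact h1
    · rcases rank_le_of_reflTransGen hqp with h2 | h2
      · exact h2.symm
      · omega

theorem le_def {p q : LevelElement w n} : p ≤ q ↔ Relation.ReflTransGen Adj p q := Iff.rfl

theorem rank_lt_of_lt {p q : LevelElement w n} (h : p < q) : p.rank < q.rank :=
  (rank_le_of_reflTransGen h.le).resolve_left h.ne

/-- Rank grows strictly along the order and by exactly one along `Adj`, so nothing fits between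
adjacent elements. -/
theorem covBy_iff {p q : LevelElement w n} : p ⋖ q ↔ Adj p q := by
  constructor
  · intro h
    rcases (Relation.ReflTransGen.cases_head (le_def.1 h.le)) with h1 | ⟨c, hpc, hcq⟩
    · exact absurd h1 h.lt.ne
    · have hlt : p < c := lt_of_le_of_ne (le_def.2 (.single hpc)) (by
        rintro rfl
        have := hpc.1
        omega)
      rcases h.eq_or_eq hlt.le (le_def.2 hcq) with rfl | rfl
      · exact absurd rfl hlt.ne
      · exact hpc
  · intro h
    refine ⟨lt_of_le_of_ne (le_def.2 (.single h)) ?_, fun c hpc hcq => ?_⟩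
    · rintro rfl
      have := h.1
      omega
    · have h1 := rank_lt_of_lt hpc
      have h2 := rank_lt_of_lt hcq
      have := h.1
      omega

theorem isRankFn (hw : IsNormalForm .single w n) (htop : LevelKind.single.level w n = .single) :
    IsRankFn (fun p : LevelElement w n => p.rank) n := by
  refine ⟨fun p q h => (covBy_iff.1 h).1, ⟨⟨0, false, Nat.zero_le n, ?_⟩, fun p => ?_, rfl⟩,
    ⟨⟨n, false, le_rfl, ?_⟩, fun p => ?_, rfl⟩⟩
  · simp [LevelKind.level, LevelKind.labels]
  · obtain ⟨i, b, hi, hb⟩ := p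
    induction i generalizing b with
    | zero =>
      simp only [LevelKind.level, LevelKind.labels, Finset.mem_singleton] at hb
      subst hb
      exact le_rfl
    | succ i ih =>
      obtain ⟨a, ha, hab⟩ := LevelStep.exists_rel_below _ _ (hw i hi) b hb
      exact (ih a (Nat.le_of_succ_le hi) ha).trans (le_def.2 (.single ⟨rfl, hab⟩))
  · simp [htop, LevelKind.labels]
  · obtain ⟨i, b, hi, hb⟩ := p
    induction hi using Nat.decreasingInduction generalizing b with
    | self =>
      simp only [htop, LevelKind.labels, Finset.mem_singleton] at hb
      subst hb
      exact le_rfl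
    | of_succ i hi ih =>
      obtain ⟨a, ha, hab⟩ := LevelStep.exists_rel_above _ _ (hw i hi) b hb
      exact le_trans (le_def.2 (.single ⟨rfl, hab⟩)) (ih a ha)

theorem isLabelling : IsLabelling (fun p : LevelElement w n => p.rank) w n fun p => p.label where
  inj _ _ h _ hL := LevelElement.ext h hL
  labels j hj b := by
    refine ⟨fun hb => ⟨⟨j, b, hj, hb⟩, rfl, rfl⟩, ?_⟩
    rintro ⟨p, rfl, rfl⟩
    exact p.label_mem
  covBy p q _ hpq := by
    rw [covBy_iff]
    exact and_iff_right hpq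

end LevelElement

theorem IsLabelling.card_level_le_two {P : Type*} [PartialOrder P] [Fintype P] {r : P → ℕ} {n : ℕ}
    {w : ℕ → LevelStep} {L : P → Bool} (hr : IsRankFn r n) (h : IsLabelling r w n L) (i : ℕ) :
    ({a : P | r a = i} : Finset P).card ≤ 2 := by
  refine (Finset.card_le_card_of_injOn L (t := Finset.univ) (fun _ _ => Finset.mem_univ _) ?_)
  intro a ha b hb hab
  simp only [Finset.coe_filter, Finset.mem_univ, true_and, Set.mem_ofPred_eq] at ha hb
  exact h.inj (ha.trans hb.symm) (hr.le a) hab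

/-! ### Transport along isomorphisms -/

section Transport

variable {P Q : Type*} [PartialOrder P] [PartialOrder Q] {r : Q → ℕ} {n : ℕ} (e : P ≃o Q)

theorem IsRankFn.comp_orderIso (h : IsRankFn r n) : IsRankFn (r ∘ e) n where
  covBy _ _ hab := h.covBy ((apply_covBy_apply_iff e).2 hab)
  bot := by
    obtain ⟨b, hb, h0⟩ := h.bot
    exact ⟨e.symm b, fun a => e.symm_apply_le.2 (hb _), by simpa using h0⟩
  top := by
    obtain ⟨t, ht, hn⟩ := h.top
    exact ⟨e.symm t, fun a => e.le_symm_apply.2 (ht _), by simpa using hn⟩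

theorem IsLabelling.comp_orderIso {w : ℕ → LevelStep} {i : ℕ} {L : Q → Bool}
    (h : IsLabelling r w i L) : IsLabelling (r ∘ e) w i (L ∘ e) where
  inj _ _ hab ha hL := e.injective (h.inj hab ha hL)
  labels j hj b := by
    rw [h.labels j hj]
    exact ⟨fun ⟨a, ha⟩ => ⟨e.symm a, by simpa using ha⟩, fun ⟨a, ha⟩ => ⟨e a, ha⟩⟩
  covBy a b ha hab := by
    rw [← apply_covBy_apply_iff e]
    exact h.covBy ha hab

end Transport

theorem IsLabelling.exists_partialOrder {P Q : Type*} [PartialOrder Q] {r : Q → ℕ} {n : ℕ}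
    {w : ℕ → LevelStep} {L : Q → Bool} (e : P ≃ Q) (hr : IsRankFn r n)
    (hL : IsLabelling r w n L) :
    ∃ (_ : PartialOrder P) (r' : P → ℕ) (L' : P → Bool), IsRankFn r' n ∧ IsLabelling r' w n L' := by
  let _ : PartialOrder P := PartialOrder.lift e e.injective
  let e' : P ≃o Q := ⟨e, Iff.rfl⟩
  exact ⟨inferInstance, _, _, hr.comp_orderIso e', hL.comp_orderIso e'⟩

/-! ### Codes and isomorphism classes -/

/-- The normal forms of length `n`, started from a level of kind `q` and ending with a single
element, that add `k` elements. Steps of index at least `n` are set to `point`. -/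
def IsCode (n : ℕ) (q : LevelKind) (k : ℕ) (w : ℕ → LevelStep) : Prop :=
  IsNormalForm q w n ∧ (∀ i, n ≤ i → w i = .point) ∧ q.level w n = .single ∧
    ∑ i ∈ Finset.range n, (q.level w (i + 1)).labels.card = k

/-- The weight `k` omits the starting level, so the least element accounts for the `+ 1`. -/
theorem IsCode.exists_mfPoset {n k : ℕ} {w : ℕ → LevelStep} (hw : IsCode n .single k w) :
    ∃ p : MFPoset n (k + 1), ∃ r L, @IsRankFn _ p.1 r n ∧ @IsLabelling _ p.1 r w n L := by
  obtain ⟨hnf, -, htop, hk⟩ := hw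
  have hr := LevelElement.isRankFn hnf htop
  have hL := LevelElement.isLabelling (w := w) (n := n)
  let _ : Fintype (LevelElement w n) := Fintype.ofFinite _
  have hcard : Fintype.card (LevelElement w n) = k + 1 := by
    rw [hL.card_eq hr, Finset.sum_range_succ', hk]
    rfl
  obtain ⟨p, r', L', hr', hL'⟩ := hL.exists_partialOrder (Fintype.equivFinOfCardEq hcard).symm hr
  exact ⟨⟨p, hr'.isGradedOfRank, hr'.hasZeroOne,
    hr'.flagHMultiplicityFree_iff.2 (hL'.card_level_le_two hr')⟩, r', L', hr', hL'⟩

theorem MFPoset.exists_isCode {n k : ℕ} (p : MFPoset n (k + 1)) :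
    ∃ w, IsCode n .single k w ∧ ∃ r L, @IsRankFn _ p.1 r n ∧ @IsLabelling _ p.1 r w n L := by
  obtain ⟨p, hgr, h01, hmf⟩ := p
  let _ := p
  have hr := hgr.isRankFn_posetRank h01
  obtain ⟨w, L, hw, hL⟩ := hr.exists_isLabelling (hr.flagHMultiplicityFree_iff.1 hmf)
  have htop : LevelKind.single.level w n = .single := by
    have hcase : ∀ q : LevelKind, (true ∈ q.labels → false ∈ q.labels → False) → q = .single := by
      decide
    refine hcase _ fun h1 h2 => ?_
    obtain ⟨a, ha, hLa⟩ := (hL.labels n le_rfl _).1 h1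
    obtain ⟨b, hb, hLb⟩ := (hL.labels n le_rfl _).1 h2
    rw [hr.eq_of_rank_eq_top ha hb, hLb] at hLa
    exact Bool.false_ne_true hLa
  -- Resetting the steps from `n` on makes the infinite word unique without changing the poset.
  set w' : ℕ → LevelStep := fun i => if i < n then w i else .point with hw'
  have hww' : ∀ j < n, w j = w' j := fun j hj => by simp [hw', hj]
  have hL' := hL.congr hww'
  refine ⟨w', ⟨fun j hj => ?_, fun i hi => by simp [hw', hi], ?_, ?_⟩, _, L, hr, hL'⟩
  · rw [← hww' j hj, ← LevelKind.level_congr fun i hi => hww' i (hi.trans hj)]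
    exact hw j hj
  · rw [← LevelKind.level_congr hww', htop]
  · have hcard := hL'.card_eq hr
    rw [Finset.sum_range_succ', Fintype.card_fin] at hcard
    exact (Nat.add_right_cancel hcard).symm

/-- Injectivity is uniqueness of the normal form, after moving a labelling along the isomorphism;
surjectivity is its existence. -/
theorem mfCount_eq_card_isCode (n k : ℕ) :
    mfCount n (k + 1) = Nat.card {w // IsCode n .single k w} := by
  choose F r L hr hL using fun w : {w // IsCode n .single k w} => w.2.exists_mfPoset
  symm
  refine Nat.card_eq_of_bijective
    (fun w => (Quotient.mk (MFPoset.isoSetoid n (k + 1)) (F w))) ⟨fun w w' h => ?_, fun c => ?_⟩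
  · obtain ⟨e⟩ := Quotient.exact h
    have h1 := @IsLabelling.comp_orderIso _ _ (F w).1 (F w').1 _ e _ _ _ (hL w')
    have h2 := @IsRankFn.comp_orderIso _ _ (F w).1 (F w').1 _ _ e (hr w')
    have hreq : r w = r w' ∘ e := by
      rw [← @IsRankFn.posetRank_eq _ (F w).1 _ _ _ (hr w),
        ← @IsRankFn.posetRank_eq _ (F w).1 _ _ _ h2]
    rw [← hreq] at h1
    have h3 := @IsLabelling.eq_of_isNormalForm _ (F w).1 _ _ _ _ _ _ (hL w) h1 w.2.1 w'.2.1
    refine Subtype.ext (funext fun j => ?_)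
    rcases Nat.lt_or_ge j n with hj | hj
    · exact h3 j hj
    · rw [w.2.2.1 j hj, w'.2.2.1 j hj]
  · induction c using Quotient.inductionOn with
    | h p =>
    obtain ⟨w, hw, r', L', hr', hL'⟩ := p.exists_isCode
    refine ⟨⟨w, hw⟩, Quotient.sound ?_⟩
    exact @IsLabelling.nonempty_orderIso _ _ (F ⟨w, hw⟩).1 p.1 _ _ _ _ _ _ _ _
      (hr ⟨w, hw⟩) hr' (hL ⟨w, hw⟩) hL'

/-- The word that starts with `l` and continues with `w`. -/
def consStep (l : LevelStep) (w : ℕ → LevelStep) : ℕ → LevelStep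
  | 0 => l
  | i + 1 => w i

theorem consStep_inj {l l' : LevelStep} {w w' : ℕ → LevelStep}
    (h : consStep l w = consStep l' w') : l = l' ∧ w = w' :=
  ⟨congrFun h 0, funext fun i => congrFun h (i + 1)⟩

theorem LevelKind.level_consStep (q : LevelKind) (l : LevelStep) (w : ℕ → LevelStep) (i : ℕ) :
    q.level (consStep l w) (i + 1) = (q.next l).level w i := by
  induction i with
  | zero => rfl
  | succ i ih =>
    rw [level, ih]
    rfl

/-- The first-step decomposition behind the recursion of `numCodes`; the bound by `k` keeps the
natural subtraction from truncating. -/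
theorem isCode_consStep {n k : ℕ} {q : LevelKind} {l : LevelStep} {w : ℕ → LevelStep} :
    IsCode (n + 1) q k (consStep l w) ↔ (q.allowed l = true ∧ (q.next l).labels.card ≤ k) ∧
      IsCode n (q.next l) (k - (q.next l).labels.card) w := by
  have h1 : IsNormalForm q (consStep l w) (n + 1) ↔
      q.allowed l = true ∧ IsNormalForm (q.next l) w n := by
    constructor
    · refine fun h => ⟨h 0 (Nat.succ_pos n), fun j hj => ?_⟩
      have := h (j + 1) (Nat.succ_lt_succ hj)
      rwa [LevelKind.level_consStep] at this
    · rintro ⟨h0, h⟩ (_ | j) hj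
      · exact h0
      · rw [LevelKind.level_consStep]
        exact h j (Nat.lt_of_succ_lt_succ hj)
  have h2 : (∀ i, n + 1 ≤ i → consStep l w i = .point) ↔ ∀ i, n ≤ i → w i = .point := by
    constructor
    · exact fun h i hi => h (i + 1) (Nat.succ_le_succ hi)
    · rintro h (_ | i) hi
      · omega
      · exact h i (Nat.le_of_succ_le_succ hi)
  unfold IsCode
  rw [h1, h2, Finset.sum_range_succ']
  simp only [LevelKind.level_consStep]
  rw [LevelKind.level]
  constructor
  · rintro ⟨⟨ha, hb⟩, hc, hd, he⟩
    exact ⟨⟨ha, by omega⟩, hb, hc, hd, by omega⟩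
  · rintro ⟨⟨ha, hf⟩, hb, hc, hd, he⟩
    exact ⟨⟨ha, hb⟩, hc, hd, by omega⟩

/-- The number of codes of length `n` and weight `k` from a level of kind `q`. -/
def numCodes : ℕ → LevelKind → ℕ → ℕ
  | 0, q, k => if q = .single ∧ k = 0 then 1 else 0
  | n + 1, q, k => ∑ l : LevelStep with q.allowed l = true ∧ (q.next l).labels.card ≤ k,
      numCodes n (q.next l) (k - (q.next l).labels.card)

theorem exists_finset_isCode (n : ℕ) (q : LevelKind) (k : ℕ) :
    ∃ A : Finset (ℕ → LevelStep), (∀ w, w ∈ A ↔ IsCode n q k w) ∧ A.card = numCodes n q k := by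
  classical
  induction n generalizing q k with
  | zero =>
    by_cases h : q = .single ∧ k = 0
    · refine ⟨{fun _ => .point}, fun w => ?_, by simp [numCodes, h]⟩
      rw [Finset.mem_singleton]
      constructor
      · rintro rfl
        exact ⟨fun j hj => absurd hj (by omega), fun _ _ => rfl, h.1, by simp [h.2]⟩
      · rintro ⟨-, hw, -⟩
        exact funext fun i => hw i (Nat.zero_le i)
    · refine ⟨∅, fun w => ?_, by simp [numCodes, h]⟩
      simp only [Finset.notMem_empty, false_iff]
      rintro ⟨-, -, hq, hk⟩
      exact h ⟨hq, by simpa using hk.symm⟩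
  | succ n ih =>
    choose A hA hcard using ih
    refine ⟨({l : LevelStep | q.allowed l = true ∧ (q.next l).labels.card ≤ k} : Finset _).biUnion
      fun l => (A (q.next l) (k - (q.next l).labels.card)).image (consStep l), fun w => ?_, ?_⟩
    · simp only [Finset.mem_biUnion, Finset.mem_filter, Finset.mem_univ, true_and,
        Finset.mem_image, hA]
      constructor
      · rintro ⟨l, hl, w', hw', rfl⟩
        exact isCode_consStep.2 ⟨hl, hw'⟩
      · intro hw
        have hcons : consStep (w 0) (fun i => w (i + 1)) = w := by
          funext i
          cases i <;> rfl
        rw [← hcons, isCode_consStep] at hw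
        exact ⟨w 0, hw.1, _, hw.2, hcons⟩
    · rw [Finset.card_biUnion, numCodes]
      · refine Finset.sum_congr rfl fun l _ => ?_
        rw [Finset.card_image_of_injective _ fun _ _ h => (consStep_inj h).2, hcard]
      · intro l _ l' _ hne
        rw [Function.onFun, Finset.disjoint_left]
        intro w hw hw'
        obtain ⟨v, -, rfl⟩ := Finset.mem_image.1 hw
        obtain ⟨v', -, h⟩ := Finset.mem_image.1 hw'
        exact hne (consStep_inj h).1.symm

theorem mfCount_eq_numCodes (n k : ℕ) : mfCount n (k + 1) = numCodes n .single k := by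
  obtain ⟨A, hA, hcard⟩ := exists_finset_isCode n .single k
  rw [mfCount_eq_card_isCode, ← hcard]
  simp_rw [← hA]
  exact Nat.card_eq_card_toFinset _ |>.trans (by simp)

/-- Every step adds an element. This rules out one-element posets of positive rank. -/
theorem numCodes_succ_zero (n : ℕ) (q : LevelKind) : numCodes (n + 1) q 0 = 0 := by
  have h : ∀ (q : LevelKind) (l : LevelStep), ¬ (q.next l).labels.card ≤ 0 := by decide
  rw [numCodes, Finset.filter_false_of_mem fun l _ hl => h q l hl.2, Finset.sum_empty]

/-! ### Generating functions and the transfer matrix -/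

section GeneratingFunctions

open MvPowerSeries

/-- The generating function of the codes from a level of kind `q`. -/
noncomputable def codeGenFun (q : LevelKind) : MvPowerSeries (Fin 2) ℚ :=
  fun m => (numCodes (m 0) q (m 1) : ℚ)

theorem coeff_codeGenFun (q : LevelKind) (m : Fin 2 →₀ ℕ) :
    coeff m (codeGenFun q) = (numCodes (m 0) q (m 1) : ℚ) := rfl

theorem coeff_X_pow_mul_X_pow_mul (a b : ℕ) (φ : MvPowerSeries (Fin 2) ℚ) (m : Fin 2 →₀ ℕ) :
    coeff m ((X 0 ^ a * X 1 ^ b) * φ) = if a ≤ m 0 ∧ b ≤ m 1 then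
      coeff (m - (Finsupp.single 0 a + Finsupp.single 1 b)) φ else 0 := by
  have h : (X 0 ^ a * X 1 ^ b : MvPowerSeries (Fin 2) ℚ) =
      monomial (Finsupp.single 0 a + Finsupp.single 1 b) 1 := by
    rw [X_pow_eq, X_pow_eq, monomial_mul_monomial, one_mul]
  rw [h, coeff_monomial_mul, one_mul]
  refine if_congr ?_ rfl rfl
  rw [Finsupp.le_def, Fin.forall_fin_two]
  simp

theorem codeGenFun_eq (q : LevelKind) : codeGenFun q = (if q = .single then 1 else 0) +
    ∑ l : LevelStep with q.allowed l = true,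
      (X 0 ^ 1 * X 1 ^ (q.next l).labels.card) * codeGenFun (q.next l) := by
  classical
  ext m
  rw [map_add, map_sum]
  simp only [coeff_X_pow_mul_X_pow_mul, coeff_codeGenFun]
  have hm : m = 0 ↔ m 0 = 0 ∧ m 1 = 0 := by
    rw [Finsupp.ext_iff, Fin.forall_fin_two]
    rfl
  have h1 : coeff m (if q = .single then 1 else 0 : MvPowerSeries (Fin 2) ℚ) =
      if q = .single ∧ m 0 = 0 ∧ m 1 = 0 then 1 else 0 := by
    by_cases hq : q = .single
    · simp [hq, coeff_one, hm]
    · simp [hq]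
  rw [h1]
  rcases h0 : m 0 with _ | n
  · simp [numCodes]
  · simp only [numCodes, Nat.succ_ne_zero, false_and, and_false, if_false, zero_add]
    rw [Nat.cast_sum, Finset.sum_filter, Finset.sum_filter]
    refine Finset.sum_congr rfl fun l _ => ?_
    by_cases ha : q.allowed l = true <;> simp [ha, h0]

theorem LevelStep.sum_univ {M : Type*} [AddCommMonoid M] (f : LevelStep → M) :
    ∑ l, f l = f .point + (f .full + (f .parallel + (f (.zig false) + f (.zig true)))) := by
  have h : (Finset.univ : Finset LevelStep) =
      {.point, .full, .parallel, .zig false, .zig true} := by decide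
  rw [h]
  simp

/-- The factor `X 1` counts the least element; the subtracted `X 1` is the empty word, the
one-element poset of rank 0. -/
theorem mfGenFun_eq : mfGenFun = X 1 * codeGenFun .single - X 1 := by
  classical
  ext m
  have h := coeff_X_pow_mul_X_pow_mul 0 1 (codeGenFun .single) m
  rw [pow_zero, pow_one, one_mul] at h
  rw [map_sub, h, coeff_codeGenFun, coeff_X]
  have hm : m = Finsupp.single 1 1 ↔ m 0 = 0 ∧ m 1 = 1 := by
    rw [Finsupp.ext_iff, Fin.forall_fin_two]
    simp
  simp only [hm]
  change (if 1 ≤ m 0 ∧ 2 ≤ m 1 then (mfCount (m 0) (m 1) : ℚ) else 0) = _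
  rcases h1 : m 1 with _ | k
  · simp
  · rw [mfCount_eq_numCodes]
    rcases h0 : m 0 with _ | n
    · simp [h0, h1, numCodes]
    · rcases k with _ | k <;> simp [h0, h1, numCodes_succ_zero]

theorem codeGenFun_single : codeGenFun .single =
    1 + X 0 * X 1 * codeGenFun .single + X 0 * X 1 ^ 2 * codeGenFun .sym := by
  conv_lhs => rw [codeGenFun_eq, Finset.sum_filter, LevelStep.sum_univ]
  simp [LevelKind.allowed, LevelKind.next, LevelKind.labels, add_assoc]

theorem codeGenFun_sym : codeGenFun .sym = X 0 * X 1 * codeGenFun .single +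
    2 * (X 0 * X 1 ^ 2 * codeGenFun .sym) + X 0 * X 1 ^ 2 * codeGenFun .asym := by
  conv_lhs => rw [codeGenFun_eq, Finset.sum_filter, LevelStep.sum_univ]
  simp [LevelKind.allowed, LevelKind.next, LevelKind.labels]
  ring

/-- The coefficient 3 collects `parallel` and both `zig` steps, which all lead to `asym`. -/
theorem codeGenFun_asym : codeGenFun .asym = X 0 * X 1 * codeGenFun .single +
    X 0 * X 1 ^ 2 * codeGenFun .sym + 3 * (X 0 * X 1 ^ 2 * codeGenFun .asym) := by
  conv_lhs => rw [codeGenFun_eq, Finset.sum_filter, LevelStep.sum_univ]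
  simp [LevelKind.allowed, LevelKind.next, LevelKind.labels]
  ring

end GeneratingFunctions

theorem theorem4 (x y : MvPowerSeries (Fin 2) ℚ)
    (hx : x = MvPowerSeries.X 0) (hy : y = MvPowerSeries.X 1) :
    mfGenFun =
      (x * y ^ 2 * (1 - x * y ^ 2) * (1 - 3 * x * y ^ 2)) *
        (1 - x * y - 5 * x * y ^ 2 + 4 * x ^ 2 * y ^ 3 + 5 * x ^ 2 * y ^ 4
          - 3 * x ^ 3 * y ^ 5)⁻¹ := by
  have h1 := codeGenFun_single
  have h2 := codeGenFun_sym
  have h3 := codeGenFun_asym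
  rw [MvPowerSeries.eq_mul_inv_iff_mul_eq (by simp [hx, hy]), mfGenFun_eq]
  rw [← hx, ← hy] at h1 h2 h3
  rw [← hy]
  -- The multipliers are the first-column cofactors of the 3 × 3 system, so they eliminate the `sym`
  -- and `asym` series; the determinant is the denominator.
  linear_combination y * ((1 - 5 * (x * y ^ 2) + 5 * (x * y ^ 2) ^ 2) * h1 +
    x * y ^ 2 * (1 - 3 * (x * y ^ 2)) * h2 + (x * y ^ 2) ^ 2 * h3)
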